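/- **Setting.** Let $n\ge 3$ and let $\mathcal N=\{1,\dots,n\}$ index nodes at pairwise distinct positions $x_1,\dots,x_n\in\mathbb R^3$, with transmit powers $q_i>0$ and integer shape parameters $m_i\ge 1$. Let $\lambda>0$ (wavelength), $r_0=\lambda/(4\pi)$, $\alpha_{\mathrm{PL}}\ge 2$ and $\mu_{ij}=\frac1{q_i}\left(\|x_i-x_j\|/r_0\right)^{\alpha_{\mathrm{PL}}}$ for $i\neq j$. Let $N>0$ (noise), $\theta\ge 1$ (threshold), and let $m\ge1$ be the number of slots. The random variables $S_1,\dots,S_n$ (slot choices) are independent and uniform on $\{1,\dots,m\}$. The received powers $P_{ij}$, $i\ne j$, are mutually independent, jointly independent of $(S_1,\dots,S_n)$, and Gamma distributed (Nakagami fading) with density $$f_{ij}(x)=\mathbf 1(x\ge 0)\,\frac{m_i^{m_i}\mu_{ij}^{m_i}}{\Gamma(m_i)}x^{m_i-1}e^{-m_i x\mu_{ij}} .$$ For $i\neq j$ and a slot $k$ put $P_{ij}^k=\delta_{S_ik}P_{ij}$, $I_{ij}^k=\sum_{l\ne i,j}P_{lj}^k$, $X_{ij}^k=\mathbf 1\left(\frac{P_{ij}^k}{N+I_{ij}^k}\ge\theta\right)$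 and $X_{ij}=\sum_{k=1}^m X_{ij}^k$ (full-duplex success of the link from $i$ to $j$). For $x\ne y$, $J\subseteq\mathcal N\setminus\{x,y\}$ and $\xi=[\xi_\nu]_{\nu\in J}\in\mathbb R^J$ let $$\gamma_{xy}^J(\xi)=e^{-\theta m_x\mu_{xy}N}\sum_{s=0}^{m_x-1}(\theta m_x\mu_{xy}N)^s\sum_{t=0}^{s}\frac{(q_x/N)^t}{(s-t)!}\sum_{\substack{\ell\in\mathbb Z_{\ge0}^J\\ \sum_{\nu\in J}\ell_\nu=t}}\ \prod_{\nu\in J}\left[(1-\xi_\nu)\delta_{0\ell_\nu}+\binom{\ell_\nu+m_\nu-1}{\ell_\nu}\frac{\xi_\nu\left(\frac1{m_\nu q_x\mu_{\nu y}}\right)^{\ell_\nu}}{\left(\theta\frac{m_x}{m_\nu}\frac{\mu_{xy}}{\mu_{\nu y}}+1\right)^{m_\nu+\ell_\nu}}\right].$$ For $x\neq y$, a node $z$ and $c\in\{0,1\}^{\mathcal N\setminus\{x,z\}}$ let $$\alpha_{xyz}(c)=\Pr\left(\frac{P_{xy}}{N+\sum_{\nu\ne x,y,z}c_\nu P_{\nu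 y}+(1-\delta_{xz})P_{zy}}\ge\theta\right)\qquad(P_{yy}:=0),$$ and for $z\ne x$, $d\in\{1,2\}$, $c\in\{0,1,2\}^{\mathcal N\setminus\{x,z\}}$ let $$\beta^{(d)}_{xyz}(c)=\Pr\left(\frac{P_{xy}}{N+\sum_{\nu\ne x,y,z}\delta_{c_\nu d}P_{\nu y}}\ge\theta\right).$$ For $i\ne j$, $k\ne l$, $(i,j)\ne(k,l)$ put $J=\mathcal N\setminus\{i,k\}$ and $$\Phi_{ijkl}=\sum_{c\in\{0,1\}^J}\ \prod_{\nu\in J}(m-1)^{1-c_\nu}\cdot\alpha_{ijk}(c)\,\alpha_{kli}(c),$$ and, for $i\ne k$, $$\Psi_{ijkl}=\sum_{c\in\{0,1,2\}^J}\ \prod_{\nu\in J}(m-2)^{\delta_{c_\nu0}}\cdot\beta^{(1)}_{ijk}(c)\,\beta^{(2)}_{kli}(c),$$ where $0^0=1$. **Corollary (Nakagami fading, full-duplex case).** 1. For $i\neq j$, $\ \mathbb E[X_{ij}]=\gamma_{ij}^{\mathcal N\setminus\{i,j\}}\left(\tfrac1m,\dots,\tfrac1m\right)$. 2. The state coefficients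 are: - for $x\ne y$: $\alpha_{xyx}(c)=\gamma_{xy}^{\mathcal N\setminus\{x,y\}}([c_\nu]_{\nu\ne x,y})$; - for $x\neq y$, $x\ne z$: $\alpha_{xyz}(c)=\gamma_{xy}^{\mathcal N\setminus\{x,y\}}(\xi)$ with $\xi_z=1$ (if $z\ne y$) and $\xi_\nu=c_\nu$ for $\nu\ne z$; - for $x\neq y$, $x\ne z$, $d=1,2$: $\beta^{(d)}_{xyz}(c)=\gamma_{xy}^{\mathcal N\setminus\{x,y,z\}}([\delta_{c_\nu d}]_{\nu\ne x,y,z})$. 3. With these closed forms inserted for $\alpha$ and $\beta$ in $\Phi$ and $\Psi$, the covariances are as follows. For $i\ne j$, $i\ne l$, $j\neq l$, $$\operatorname{cov}(X_{ij},X_{il})=\frac{\Phi_{ijil}}{m^{n-1}}-\mathbb E[X_{ij}]\,\mathbb E[X_{il}],$$ and for $i\ne j$, $k\ne l$, $i\ne k$, $$\operatorname{cov}(X_{ij},X_{kl})=\frac{1-\delta_{lj}}{m^{n-1}}\,\Phi_{ijkl}+\frac{m-1}{m^{n-1}}\,\Psi_{ijkl}-\mathbb E[X_{ij}]\,\mathbb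 E[X_{kl}].$$ -/

import Mathlib

open MeasureTheory ProbabilityTheory

/-- The deterministic data of the network: `n` nodes at fixed, pairwise distinct positions in `ℝ³`,
transmit powers, integer Nakagami shape parameters, wavelength, path loss coefficient, thermal
noise, SINR threshold and number of slots per frame. -/
structure Network (n : ℕ) where
  /-- node positions -/
  pos : Fin n → EuclideanSpace ℝ (Fin 3)
  pos_injective : Function.Injective pos
  /-- transmit powers -/
  q : Fin n → ℝ
  q_pos : ∀ i, 0 < q i
  /-- integer Nakagami shape parameters -/
  shape : Fin n → ℕ
  shape_pos : ∀ i, 0 < shape i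
  /-- wavelength of the carrier wave -/
  wavelength : ℝ
  wavelength_pos : 0 < wavelength
  /-- path loss coefficient -/
  pathLoss : ℝ
  two_le_pathLoss : 2 ≤ pathLoss
  /-- thermal noise -/
  noise : ℝ
  noise_pos : 0 < noise
  /-- SINR threshold -/
  θ : ℝ
  one_le_θ : 1 ≤ θ
  /-- number of slots per frame -/
  slots : ℕ
  slots_pos : 0 < slots

namespace Network

noncomputable section

variable {n : ℕ} (net : Network n)

/-- Reference distance `r₀ = λ / (4π)`. -/
def refDist : ℝ := net.wavelength / (4 * Real.pi)

/-- `μ_ij = (‖x_i - x_j‖ / r₀) ^ α_PL / q_i`, the inverse of the average power of a transmission of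
node `i` received at node `j`. -/
def mu (i j : Fin n) : ℝ :=
  1 / net.q i * (‖net.pos i - net.pos j‖ / net.refDist) ^ net.pathLoss

section Random

variable {Ω : Type*}

/-- Power `P_ij^k = δ_{S_i k} P_ij` received at `j` from `i` in slot `k`. -/
def slotPower (P : Fin n → Fin n → Ω → ℝ) (S : Fin n → Ω → Fin net.slots)
    (k : Fin net.slots) (i j : Fin n) (ω : Ω) : ℝ :=
  if S i ω = k then P i j ω else 0

/-- Interference `I_ij^k`, the sum of `P_lj^k` over `l ≠ i, j`. -/
def interference (P : Fin n → Fin n → Ω → ℝ) (S : Fin n → Ω → Fin net.slots)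
    (k : Fin net.slots) (i j : Fin n) (ω : Ω) : ℝ :=
  ∑ l ∈ Finset.univ \ {i, j}, net.slotPower P S k l j ω

open Classical in
/-- Indicator `X_ij^k` of excess of the SINR threshold in slot `k`. -/
def slotSuccess (P : Fin n → Fin n → Ω → ℝ) (S : Fin n → Ω → Fin net.slots)
    (k : Fin net.slots) (i j : Fin n) (ω : Ω) : ℝ :=
  if net.θ ≤ net.slotPower P S k i j ω / (net.noise + net.interference P S k i j ω) then 1 else 0

/-- Full-duplex success variable `X_ij`, the sum of `X_ij^k` over all slots `k`. -/
def X (P : Fin n → Fin n → Ω → ℝ) (S : Fin n → Ω → Fin net.slots) (i j : Fin n) (ω : Ω) : ℝ :=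
  ∑ k : Fin net.slots, net.slotSuccess P S k i j ω

/-- The probabilistic model: the slot choices are independent and uniform, the received powers
`P_ij`, `i ≠ j`, are mutually independent and Gamma distributed with density
`m_i ^ m_i μ_ij ^ m_i / Γ(m_i) x ^ (m_i - 1) exp (- m_i x μ_ij)` on `x ≥ 0`, and the family of
powers is independent of the family of slot choices. Nothing is assumed about `P i i`. -/
structure IsNakagamiALOHA [MeasurableSpace Ω] (Pr : Measure Ω)
    (P : Fin n → Fin n → Ω → ℝ) (S : Fin n → Ω → Fin net.slots) : Prop where
  measurable_slot : ∀ i, Measurable (S i)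
  slot_uniform : ∀ i s, Pr.real {ω | S i ω = s} = 1 / net.slots
  slot_indep : iIndepFun S Pr
  measurable_power : ∀ i j, i ≠ j → Measurable (P i j)
  power_law : ∀ i j, i ≠ j →
    Pr.map (P i j) = gammaMeasure (net.shape i) (net.shape i * net.mu i j)
  power_indep : iIndepFun (fun (p : {p : Fin n × Fin n // p.1 ≠ p.2}) => P p.1.1 p.1.2) Pr
  power_indep_slot : IndepFun
    (fun ω (p : {p : Fin n × Fin n // p.1 ≠ p.2}) => P p.1.1 p.1.2 ω) (fun ω i => S i ω) Pr

/-- State coefficient `α_xyz(c)`: the probability that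
`P_xy / (N + ∑_{ν ≠ x,y,z} c_ν P_νy + (1 - δ_xz) P_zy) ≥ θ`. The receiver `y` does not interfere
with itself, so the last summand is also absent for `z = y`. -/
def alpha [MeasurableSpace Ω] (Pr : Measure Ω) (P : Fin n → Fin n → Ω → ℝ)
    (x y z : Fin n) (c : Fin n → ℕ) : ℝ :=
  Pr.real {ω | net.θ ≤ P x y ω / (net.noise + (∑ ν ∈ Finset.univ \ {x, y, z}, (c ν : ℝ) * P ν y ω)
    + (if z = x ∨ z = y then 0 else P z y ω))}

/-- State coefficient `β_xyz^(d)(c)`: the probability that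
`P_xy / (N + ∑_{ν ≠ x,y,z} δ_{c_ν d} P_νy) ≥ θ`. -/
def beta [MeasurableSpace Ω] (Pr : Measure Ω) (P : Fin n → Fin n → Ω → ℝ)
    (d : ℕ) (x y z : Fin n) (c : Fin n → ℕ) : ℝ :=
  Pr.real {ω | net.θ ≤ P x y ω / (net.noise +
    ∑ ν ∈ Finset.univ \ {x, y, z}, (if c ν = d then 1 else 0) * P ν y ω)}

end Random

/-- The closed form `γ_xy^J(ξ)`. Only the values `ξ ν`, `ν ∈ J`, matter. The innermost sum runs over
all families `ℓ` of natural numbers indexed by `J` with sum `t` (extended by `0` outside `J`). -/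
def gamma (x y : Fin n) (J : Finset (Fin n)) (ξ : Fin n → ℝ) : ℝ :=
  Real.exp (-(net.θ * net.shape x * net.mu x y * net.noise)) *
    ∑ s ∈ Finset.range (net.shape x), (net.θ * net.shape x * net.mu x y * net.noise) ^ s *
      ∑ t ∈ Finset.range (s + 1), (net.q x / net.noise) ^ t / ((s - t).factorial : ℝ) *
        ∑ ℓ ∈ Finset.piAntidiag J t, ∏ ν ∈ J,
          ((1 - ξ ν) * (if ℓ ν = 0 then 1 else 0) +
            ((ℓ ν + net.shape ν - 1).choose (ℓ ν) : ℝ) *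
              (ξ ν * (1 / (net.shape ν * net.q x * net.mu ν y)) ^ ℓ ν /
                (net.θ * (net.shape x / net.shape ν) * (net.mu x y / net.mu ν y) + 1) ^
                  (net.shape ν + ℓ ν)))

/-- The total macro states `[c_ν]_{ν ∈ J}` with `c_ν ∈ {0, …, r - 1}`, encoded as functions on all
nodes by the value `0` outside `J`. -/
def macroStates (J : Finset (Fin n)) (r : ℕ) : Finset (Fin n → ℕ) :=
  Fintype.piFinset fun ν => if ν ∈ J then Finset.range r else {0}

/-- State weight `φ(c) = ∏_{ν ∈ J} (m - 1) ^ (1 - c_ν)`, used for `c_ν ∈ {0, 1}`. -/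
def phi (J : Finset (Fin n)) (c : Fin n → ℕ) : ℝ :=
  ∏ ν ∈ J, ((net.slots : ℝ) - 1) ^ (1 - c ν)

/-- State weight `ψ(c) = ∏_{ν ∈ J} (m - 2) ^ δ_{c_ν 0}`. -/
def psi (J : Finset (Fin n)) (c : Fin n → ℕ) : ℝ :=
  ∏ ν ∈ J, ((net.slots : ℝ) - 2) ^ (if c ν = 0 then 1 else 0)

/-- `Φ_ijkl^J(w, a) = ∑_c w(c) a_ijk(c) a_kli(c)`, sum over `c ∈ {0,1}^J`. -/
def Phi (J : Finset (Fin n)) (w : (Fin n → ℕ) → ℝ)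
    (a : Fin n → Fin n → Fin n → (Fin n → ℕ) → ℝ) (i j k l : Fin n) : ℝ :=
  ∑ c ∈ macroStates J 2, w c * a i j k c * a k l i c

/-- `Ψ_ijkl^J(w, b) = ∑_c w(c) b_ijk^(1)(c) b_kli^(2)(c)`, sum over `c ∈ {0,1,2}^J`. -/
def Psi (J : Finset (Fin n)) (w : (Fin n → ℕ) → ℝ)
    (b : ℕ → Fin n → Fin n → Fin n → (Fin n → ℕ) → ℝ) (i j k l : Fin n) : ℝ :=
  ∑ c ∈ macroStates J 3, w c * b 1 i j k c * b 2 k l i c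

/-- Closed form of `α_xyx(c)`: `γ_xy` at the tuple `[c_ν]_{ν ≠ x,y}`. -/
def alphaSame (x y : Fin n) (c : Fin n → ℕ) : ℝ :=
  net.gamma x y (Finset.univ \ {x, y}) fun ν => (c ν : ℝ)

/-- Closed form of `α_xyz(c)`, `z ≠ x`: `γ_xy` at the tuple `[ξ_ν]_{ν ≠ x,y}` with `ξ_z = 1` and
`ξ_ν = c_ν` for `ν ≠ z`. -/
def alphaClosed (x y z : Fin n) (c : Fin n → ℕ) : ℝ :=
  net.gamma x y (Finset.univ \ {x, y}) fun ν => if ν = z then 1 else (c ν : ℝ)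

/-- Closed form of `β_xyz^(d)(c)`: `γ_xy` at the tuple `[δ_{c_ν d}]_{ν ≠ x,y,z}`. -/
def betaClosed (d : ℕ) (x y z : Fin n) (c : Fin n → ℕ) : ℝ :=
  net.gamma x y (Finset.univ \ {x, y, z}) fun ν => if c ν = d then 1 else 0

end

end Network

/-! ### Gamma laws of integer shape: tail and weighted moments. -/

section GammaDistribution

open Real Set Filter Topology

/-! The slot vector is uniform on `m ^ n` values and independent of the powers, so every expectation
is an average over slot vectors `s` of a probability that involves powers only. In the slot of its
transmitter, the link from `i` to `j` has a fixed interferer set `T` (`interferers s i j`); in all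
other slots it fails because the signal is zero.

For fixed `T`, a Gamma variable of integer shape has tail `exp (-(r t))` times a truncated
exponential series. Evaluated at `t = θ (N + I)`, this series splits by the binomial and multinomial
theorems into products over nodes, whose expectations factor by independence into one-dimensional
Gamma integrals. A silent node contributes only the Kronecker delta, so the success probability is
`gamma` at the indicator of `T` (`measureReal_successSet`). Since `gamma` is affine in each
coordinate `ξ ν`, and given the slot of `i` the indicators of sharing it are independent with mean
`1 / m`, averaging puts `1 / m` in every coordinate (`sum_gamma_slots`).

For covariances, two successes under a fixed `s` depend on disjoint sets of powers when the
receivers or the slots differ, and their probabilities multiply (`measureReal_successSet_inter`).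
Distinct transmitters in one slot with a common receiver cannot both succeed, because `θ ≥ 1` and `N
> 0`. Slot vectors are then grouped by which transmitter slot, if any, each other node chose; the
powers of `m - 1` and `m - 2` count the remaining slots (`sum_slots_eq_sum_macroStates`). -/

theorem integral_gammaMeasure_nat {j : ℕ} {r : ℝ} (hr : 0 < r) (f : ℝ → ℝ) :
    ∫ x, f x ∂gammaMeasure ((j + 1 : ℕ) : ℝ) r
      = ∫ x in Ioi (0 : ℝ), r ^ (j + 1) / (j.factorial : ℝ) * x ^ j * exp (-(r * x)) * f x := by
  have hj : (0 : ℝ) < ((j + 1 : ℕ) : ℝ) := by positivity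
  rw [gammaMeasure, integral_withDensity_eq_integral_toReal_smul (f := gammaPDF _ _)
    (measurable_gammaPDFReal _ _).ennreal_ofReal (ae_of_all _ fun x => ENNReal.ofReal_lt_top),
    ← integral_Ici_eq_integral_Ioi, ← integral_indicator measurableSet_Ici]
  congr 1 with x
  rw [gammaPDF, ENNReal.toReal_ofReal (gammaPDFReal_nonneg hj hr x), gammaPDFReal, indicator_apply]
  simp only [mem_Ici, smul_eq_mul]
  split_ifs with hx
  · rw [rpow_natCast]
    push_cast
    rw [Gamma_nat_eq_factorial, add_sub_cancel_right, rpow_natCast]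
  · simp

theorem ae_nonneg_gammaMeasure (a r : ℝ) : ∀ᵐ x ∂gammaMeasure a r, 0 ≤ x := by
  rw [ae_iff, gammaMeasure]
  simp only [not_le]
  rw [show {x : ℝ | x < 0} = Iio 0 from rfl, withDensity_apply _ measurableSet_Iio]
  exact lintegral_gammaPDF_of_nonpos le_rfl

/-- The product rule telescopes: each new term of the series cancels the derivative left by the
previous one and leaves the next Gamma density. -/
theorem hasDerivAt_exp_neg_mul_sum (r t : ℝ) (j : ℕ) :
    HasDerivAt (fun t => -(exp (-(r * t)) * ∑ s ∈ Finset.range (j + 1), (r * t) ^ s / s.factorial))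
      (r ^ (j + 1) / (j.factorial : ℝ) * t ^ j * exp (-(r * t))) t := by
  have he : HasDerivAt (fun t => exp (-(r * t))) (exp (-(r * t)) * -r) t := by
    simpa using (((hasDerivAt_id t).const_mul r).neg).exp
  induction j with
  | zero =>
    convert! he.neg using 1
    · ext; simp
    · simp [mul_comm]
  | succ j ih =>
    simp_rw [Finset.sum_range_succ _ (j + 1), mul_add, neg_add]
    have h2 : HasDerivAt (fun t => (r * t) ^ (j + 1) / ((j + 1).factorial : ℝ))
        (((j + 1 : ℕ) : ℝ) * (r * t) ^ j * r / ((j + 1).factorial : ℝ)) t := by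
      simpa using ((((hasDerivAt_id t).const_mul r).pow (j + 1)).div_const
        ((j + 1).factorial : ℝ))
    convert! ih.add (he.mul h2).neg using 1
    rw [Nat.factorial_succ]
    push_cast
    field_simp
    ring

theorem gammaMeasure_real_Ici {j : ℕ} {r t : ℝ} (hr : 0 < r) (ht : 0 ≤ t) :
    (gammaMeasure ((j + 1 : ℕ) : ℝ) r).real (Ici t)
      = exp (-(r * t)) * ∑ s ∈ Finset.range (j + 1), (r * t) ^ s / s.factorial := by
  have hlim : Tendsto (fun t => -(exp (-(r * t)) *
      ∑ s ∈ Finset.range (j + 1), (r * t) ^ s / s.factorial)) atTop (𝓝 (-0)) := by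
    refine Tendsto.neg ?_
    simp_rw [Finset.mul_sum]
    rw [show (0 : ℝ) = ∑ s ∈ Finset.range (j + 1), 0 by simp]
    refine tendsto_finsetSum _ fun s _ => ?_
    have := ((tendsto_pow_mul_exp_neg_atTop_nhds_zero s).comp
      (tendsto_id.const_mul_atTop hr)).mul_const (1 / (s.factorial : ℝ))
    rw [zero_mul] at this
    refine this.congr fun x => ?_
    simp
    ring
  have hint := integral_Ioi_of_hasDerivAt_of_nonneg' (a := t)
    (fun x _ => hasDerivAt_exp_neg_mul_sum r x j)
    (fun x hx => by have : 0 ≤ x := ht.trans (le_of_lt hx); positivity) hlim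
  rw [← integral_indicator_one measurableSet_Ici, integral_gammaMeasure_nat hr]
  rw [neg_zero, zero_sub, neg_neg] at hint
  rw [← hint, ← integral_Ici_eq_integral_Ioi, ← integral_Ici_eq_integral_Ioi,
    ← integral_indicator measurableSet_Ici, ← integral_indicator measurableSet_Ici]
  congr 1 with x
  simp only [indicator_apply, mem_Ici, Pi.one_apply]
  split_ifs <;> first | exact absurd (ht.trans ‹_›) ‹_› | simp

/-- The weight tilts the density to rate `r + c` and shape `j + l + 1`; the binomial coefficient is
`Γ(j + l + 1) / (j! l!)`. -/
theorem integral_pow_mul_exp_neg_gammaMeasure {j l : ℕ} {r c : ℝ} (hr : 0 < r) (hc : 0 ≤ c) :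
    ∫ x, x ^ l / (l.factorial : ℝ) * exp (-(c * x)) ∂gammaMeasure ((j + 1 : ℕ) : ℝ) r
      = ((l + j).choose l : ℝ) * ((1 / r) ^ l / (c / r + 1) ^ (j + 1 + l)) := by
  have h := integral_rpow_mul_exp_neg_mul_Ioi (a := ((j + l + 1 : ℕ) : ℝ)) (r := r + c)
    (by positivity) (by positivity)
  rw [integral_gammaMeasure_nat hr]
  calc _ = ∫ x in Ioi (0 : ℝ), r ^ (j + 1) / (j.factorial : ℝ) / (l.factorial : ℝ) *
        (x ^ ((((j + l + 1 : ℕ) : ℝ)) - 1) * exp (-((r + c) * x))) := by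
        congr 1 with x
        rw [show (((j + l + 1 : ℕ) : ℝ)) - 1 = ((j + l : ℕ) : ℝ) by push_cast; ring, rpow_natCast,
          add_mul, neg_add, exp_add]
        ring
    _ = _ := by
        rw [integral_const_mul, h, rpow_natCast]
        push_cast
        rw [show (j : ℝ) + l + 1 = ((j + l : ℕ) : ℝ) + 1 by push_cast; ring,
          Gamma_nat_eq_factorial, Nat.cast_choose ℝ (Nat.le_add_right l j),
          Nat.add_sub_cancel_left, add_comm l j,
          show c / r + 1 = (r + c) / r by field_simp; ring]
        have : r + c ≠ 0 := by positivity
        simp only [div_pow, one_pow, pow_succ, pow_add]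
        field_simp

end GammaDistribution

/-! ### A Gamma signal against noise and independent interference. -/

section Threshold

open Real

theorem sum_pow_div_factorial {ι : Type*} [DecidableEq ι] (J : Finset ι) (y : ι → ℝ) (t : ℕ) :
    (∑ ν ∈ J, y ν) ^ t / (t.factorial : ℝ)
      = ∑ ℓ ∈ Finset.piAntidiag J t, ∏ ν ∈ J, y ν ^ ℓ ν / ((ℓ ν).factorial : ℝ) := by
  rw [Finset.sum_pow_eq_sum_piAntidiag, Finset.sum_div]
  refine Finset.sum_congr rfl fun ℓ hℓ => ?_
  have h := Nat.multinomial_spec J ℓ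
  rw [(Finset.mem_piAntidiag.1 hℓ).1] at h
  have h' : (∏ ν ∈ J, ((ℓ ν).factorial : ℝ)) * Nat.multinomial J ℓ = t.factorial := by
    exact_mod_cast h
  have hp : (∏ ν ∈ J, ((ℓ ν).factorial : ℝ)) ≠ 0 :=
    Finset.prod_ne_zero_iff.2 fun ν _ => by positivity
  have hm : (Nat.multinomial J ℓ : ℝ) ≠ 0 := by exact_mod_cast (Nat.multinomial_pos J ℓ).ne'
  rw [Finset.prod_div_distrib, ← h']
  field_simp

/-- The binomial theorem separates noise from interference, the multinomial theorem separates the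
interferers, and the exponential of a sum is distributed over the same product. Pulling out `(c * N)
^ s` leaves `1 / N ^ t`. -/
theorem exp_neg_mul_sum_add {ι : Type*} [DecidableEq ι] (J : Finset ι) (y : ι → ℝ) {c N : ℝ}
    (hN : N ≠ 0) (k : ℕ) :
    exp (-(c * (N + ∑ ν ∈ J, y ν))) *
        ∑ s ∈ Finset.range k, (c * (N + ∑ ν ∈ J, y ν)) ^ s / (s.factorial : ℝ)
      = exp (-(c * N)) * ∑ s ∈ Finset.range k, (c * N) ^ s *
          ∑ t ∈ Finset.range (s + 1), (1 / (N ^ t * ((s - t).factorial : ℝ))) *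
            ∑ ℓ ∈ Finset.piAntidiag J t,
              ∏ ν ∈ J, (y ν ^ ℓ ν / ((ℓ ν).factorial : ℝ) * exp (-(c * y ν))) := by
  simp_rw [Finset.prod_mul_distrib, ← Finset.sum_mul, ← exp_sum, Finset.sum_neg_distrib,
    ← Finset.mul_sum, ← sum_pow_div_factorial, mul_add, neg_add, exp_add, ← mul_add, mul_assoc]
  congr 1
  rw [mul_comm, Finset.sum_mul]
  refine Finset.sum_congr rfl fun s _ => ?_
  simp_rw [← mul_assoc]
  rw [← Finset.sum_mul, ← mul_assoc]
  congr 1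
  rw [mul_pow, add_comm N, add_pow, Finset.mul_sum, Finset.sum_div, Finset.mul_sum]
  refine Finset.sum_congr rfl fun t ht => ?_
  have hts : t ≤ s := Nat.lt_succ_iff.1 (Finset.mem_range.1 ht)
  rw [Nat.cast_choose ℝ hts, mul_pow, ← Nat.sub_add_cancel hts, pow_add N]
  simp only [Nat.add_sub_cancel]
  field_simp

theorem pow_div_factorial_mul_exp_neg_le {c y : ℝ} (hc : 0 < c) (hy : 0 ≤ y) (l : ℕ) :
    y ^ l / (l.factorial : ℝ) * exp (-(c * y)) ≤ (1 / c) ^ l := by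
  have h := pow_div_factorial_le_exp (c * y) (mul_nonneg hc.le hy) l
  rw [exp_neg, ← div_eq_mul_inv, div_le_iff₀ (exp_pos _), one_div, inv_pow, ← div_eq_inv_mul,
    le_div_iff₀ (by positivity)]
  rw [mul_pow] at h
  linarith [mul_comm (c ^ l) (y ^ l), mul_div_right_comm (y ^ l) (c ^ l) (l.factorial : ℝ),
    mul_div_assoc (c ^ l) (y ^ l) (l.factorial : ℝ)]

variable {Ω ι : Type*} [MeasurableSpace Ω] {Pr : Measure Ω} [IsProbabilityMeasure Pr]

/-- Condition on the interference: by independence and Fubini the inner probability is a Gamma tail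
at `θ * (N + I)`. -/
theorem measureReal_threshold_le_gamma {W I : Ω → ℝ} {j : ℕ} {r θ N : ℝ}
    (hr : 0 < r) (hθ : 0 ≤ θ) (hN : 0 ≤ N) (hW : Measurable W) (hI : Measurable I)
    (hI0 : ∀ᵐ ω ∂Pr, 0 ≤ I ω) (hind : IndepFun I W Pr)
    (hlaw : Pr.map W = gammaMeasure ((j + 1 : ℕ) : ℝ) r) :
    Pr.real {ω | θ * (N + I ω) ≤ W ω}
      = ∫ ω, exp (-(r * θ * (N + I ω))) *
          ∑ s ∈ Finset.range (j + 1), (r * θ * (N + I ω)) ^ s / (s.factorial : ℝ) ∂Pr := by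
  have hB : MeasurableSet {p : ℝ × ℝ | θ * (N + p.1) ≤ p.2} :=
    measurableSet_le (by fun_prop) (by fun_prop)
  have hWp : IsProbabilityMeasure (Pr.map W) := Measure.isProbabilityMeasure_map hW.aemeasurable
  have hIp : IsProbabilityMeasure (Pr.map I) := Measure.isProbabilityMeasure_map hI.aemeasurable
  calc Pr.real {ω | θ * (N + I ω) ≤ W ω}
      = (Pr.map fun ω => (I ω, W ω)).real {p : ℝ × ℝ | θ * (N + p.1) ≤ p.2} := by
        rw [map_measureReal_apply (hI.prodMk hW) hB]; rfl
    _ = ∫ a, (Pr.map W).real (Set.Ici (θ * (N + a))) ∂(Pr.map I) := by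
        rw [hind.map_prod_eq_prod_map_map hI.aemeasurable hW.aemeasurable,
          ← integral_indicator_one hB, integral_prod ({p : ℝ × ℝ | θ * (N + p.1) ≤ p.2}.indicator 1)
            ((integrable_const (1 : ℝ)).indicator hB)]
        congr 1 with a
        rw [← integral_indicator_one measurableSet_Ici]
        rfl
    _ = ∫ ω, (Pr.map W).real (Set.Ici (θ * (N + I ω))) ∂Pr := by
        refine integral_map hI.aemeasurable (Measurable.aestronglyMeasurable ?_)
        refine Antitone.measurable fun a b hab => measureReal_mono ?_
        exact Set.Ici_subset_Ici.2 (by gcongr)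
    _ = _ := by
        refine integral_congr_ae ?_
        filter_upwards [hI0] with ω hω
        rw [hlaw, gammaMeasure_real_Ici hr (by positivity)]
        simp only [mul_assoc]

theorem measureReal_threshold_le_sum [DecidableEq ι] {J : Finset ι} {W : Ω → ℝ} {Y : ι → Ω → ℝ}
    {j : ℕ} {r θ N : ℝ} (hr : 0 < r) (hθ : 0 < θ) (hN : 0 < N) (hW : Measurable W)
    (hY : ∀ ν ∈ J, Measurable (Y ν)) (hY0 : ∀ ν ∈ J, ∀ᵐ ω ∂Pr, 0 ≤ Y ν ω)
    (hYind : iIndepFun (fun ν : J => Y ν) Pr)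
    (hind : IndepFun (fun ω => ∑ ν ∈ J, Y ν ω) W Pr)
    (hlaw : Pr.map W = gammaMeasure ((j + 1 : ℕ) : ℝ) r) :
    Pr.real {ω | θ * (N + ∑ ν ∈ J, Y ν ω) ≤ W ω}
      = exp (-(r * θ * N)) * ∑ s ∈ Finset.range (j + 1), (r * θ * N) ^ s *
          ∑ t ∈ Finset.range (s + 1), (1 / (N ^ t * ((s - t).factorial : ℝ))) *
            ∑ ℓ ∈ Finset.piAntidiag J t,
              ∏ ν ∈ J, ∫ ω, Y ν ω ^ ℓ ν / ((ℓ ν).factorial : ℝ) * exp (-(r * θ * Y ν ω)) ∂Pr := by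
  have hall : ∀ᵐ ω ∂Pr, ∀ ν ∈ J, 0 ≤ Y ν ω := by
    rwa [Filter.eventually_all_finset J]
  rw [measureReal_threshold_le_gamma hr hθ.le hN.le hW (Finset.measurable_fun_sum J hY)
    (hall.mono fun ω h => Finset.sum_nonneg h) hind hlaw]
  simp_rw [exp_neg_mul_sum_add J _ hN.ne']
  -- Each factor is bounded almost surely, which gives the integrability needed to exchange
  -- expectation and finite sums.
  have hi : ∀ ℓ : ι → ℕ, Integrable (fun ω =>
      ∏ ν ∈ J, (Y ν ω ^ ℓ ν / ((ℓ ν).factorial : ℝ) * exp (-(r * θ * Y ν ω)))) Pr := by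
    intro ℓ
    refine Integrable.of_bound (C := ∏ ν ∈ J, (1 / (r * θ)) ^ ℓ ν)
      (Finset.measurable_fun_prod J fun ν hν => ?_).aestronglyMeasurable ?_
    · have := hY ν hν
      fun_prop
    · filter_upwards [hall] with ω hω
      rw [norm_of_nonneg (Finset.prod_nonneg fun ν hν => by have := hω ν hν; positivity)]
      exact Finset.prod_le_prod (fun ν hν => by have := hω ν hν; positivity)
        fun ν hν => pow_div_factorial_mul_exp_neg_le (by positivity) (hω ν hν) _
  rw [integral_const_mul, integral_finsetSum _ fun s _ => ?_]
  swap
  · exact (integrable_finsetSum _ fun t _ =>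
      (integrable_finsetSum _ fun ℓ _ => hi ℓ).const_mul _).const_mul _
  congr 1
  refine Finset.sum_congr rfl fun s _ => ?_
  rw [integral_const_mul, integral_finsetSum _ fun t _ =>
    (integrable_finsetSum _ fun ℓ _ => hi ℓ).const_mul _]
  congr 1
  refine Finset.sum_congr rfl fun t _ => ?_
  rw [integral_const_mul, integral_finsetSum _ fun ℓ _ => hi ℓ]
  congr 1
  refine Finset.sum_congr rfl fun ℓ _ => ?_
  simp_rw [← Finset.prod_coe_sort J]
  exact iIndepFun.integral_fun_prod_comp (X := fun ν : J => Y ν)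
    (f := fun ν x => x ^ ℓ ν / ((ℓ ν).factorial : ℝ) * exp (-(r * θ * x))) hYind
    (fun ν => (hY ν ν.2).aemeasurable) fun ν => by fun_prop

end Threshold

namespace Network

variable {n : ℕ}

/-! ### Events determined by the powers of a set of links. -/

section PowerSigma

variable {Ω : Type*}

/-- The σ-algebra generated by the powers `P_ij`, `i ≠ j`, with `(i, j) ∈ U`. -/
@[reducible]
def powerSigma (P : Fin n → Fin n → Ω → ℝ) (U : Set (Fin n × Fin n)) : MeasurableSpace Ω :=
  ⨆ p ∈ {p : {p : Fin n × Fin n // p.1 ≠ p.2} | p.1 ∈ U},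
    MeasurableSpace.comap (P p.1.1 p.1.2) inferInstance

/-- The event that the link from `x` to `y` exceeds the threshold when exactly the nodes in `T`
interfere. -/
def successSet (net : Network n) (P : Fin n → Fin n → Ω → ℝ) (x y : Fin n) (T : Finset (Fin n)) :
    Set Ω :=
  {ω | net.θ ≤ P x y ω / (net.noise + ∑ ν ∈ T, P ν y ω)}

theorem measurable_powerSigma (P : Fin n → Fin n → Ω → ℝ) {U : Set (Fin n × Fin n)} {i j : Fin n}
    (hij : i ≠ j) (hU : (i, j) ∈ U) : Measurable[powerSigma P U] (P i j) := by
  refine measurable_iff_comap_le.2 ?_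
  exact le_iSup₂_of_le (f := fun (p : {p : Fin n × Fin n // p.1 ≠ p.2})
    (_ : p ∈ {p : {p : Fin n × Fin n // p.1 ≠ p.2} | p.1 ∈ U}) =>
      MeasurableSpace.comap (P p.1.1 p.1.2) inferInstance) ⟨(i, j), hij⟩ hU le_rfl

theorem measurable_sum_powerSigma (P : Fin n → Fin n → Ω → ℝ) {U : Set (Fin n × Fin n)} {y : Fin n}
    {T : Finset (Fin n)} (hyT : y ∉ T) (hU : ∀ ν ∈ T, (ν, y) ∈ U) :
    Measurable[powerSigma P U] fun ω => ∑ ν ∈ T, P ν y ω :=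
  Finset.measurable_fun_sum T fun ν hν =>
    measurable_powerSigma P (ne_of_mem_of_not_mem hν hyT) (hU ν hν)

theorem measurableSet_successSet (net : Network n) (P : Fin n → Fin n → Ω → ℝ)
    {U : Set (Fin n × Fin n)} {x y : Fin n} {T : Finset (Fin n)} (hxy : x ≠ y) (hyT : y ∉ T)
    (hx : (x, y) ∈ U) (hU : ∀ ν ∈ T, (ν, y) ∈ U) :
    MeasurableSet[powerSigma P U] (net.successSet P x y T) := by
  let := powerSigma P U
  have h1 := measurable_powerSigma P hxy hx
  have h2 := measurable_sum_powerSigma P hyT hU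
  exact measurableSet_le measurable_const (h1.div (h2.const_add _))

end PowerSigma

theorem mu_pos (net : Network n) {i j : Fin n} (hij : i ≠ j) : 0 < net.mu i j := by
  have h1 := net.q_pos i
  have h2 : 0 < ‖net.pos i - net.pos j‖ :=
    norm_pos_iff.2 (sub_ne_zero.2 (net.pos_injective.ne hij))
  have h3 : 0 < net.refDist := div_pos net.wavelength_pos (by positivity)
  unfold mu
  positivity

theorem slots_pos_real (net : Network n) : (0 : ℝ) < net.slots := by
  exact_mod_cast net.slots_pos

theorem θ_pos (net : Network n) : 0 < net.θ := zero_lt_one.trans_le net.one_le_θ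

/-! ### Success probability for a fixed set of interferers. -/

namespace IsNakagamiALOHA

variable {net : Network n} {Ω : Type*} [MeasurableSpace Ω] {Pr : Measure Ω}
  {P : Fin n → Fin n → Ω → ℝ} {S : Fin n → Ω → Fin net.slots}

theorem powerSigma_le (h : net.IsNakagamiALOHA Pr P S) (U : Set (Fin n × Fin n)) :
    powerSigma P U ≤ ‹MeasurableSpace Ω› :=
  iSup₂_le fun p _ => (h.measurable_power _ _ p.2).comap_le

theorem indep_powerSigma (h : net.IsNakagamiALOHA Pr P S) {U V : Set (Fin n × Fin n)}
    (hUV : Disjoint U V) : Indep (powerSigma P U) (powerSigma P V) Pr := by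
  refine indep_iSup_of_disjoint (fun p => (h.measurable_power _ _ p.2).comap_le)
    h.power_indep.iIndep ?_
  exact Set.disjoint_left.2 fun p hp hq => Set.disjoint_left.1 hUV hp hq

theorem ae_nonneg_power (h : net.IsNakagamiALOHA Pr P S) :
    ∀ᵐ ω ∂Pr, ∀ i j : Fin n, i ≠ j → 0 ≤ P i j ω := by
  rw [ae_all_iff]
  intro i
  rw [ae_all_iff]
  intro j
  by_cases hij : i = j
  · simp [hij]
  · have := ae_nonneg_gammaMeasure (net.shape i) (net.shape i * net.mu i j)
    rw [← h.power_law i j hij] at this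
    filter_upwards [ae_of_ae_map (h.measurable_power i j hij).aemeasurable this] with ω hω _
    exact hω

/-- The factor `q x ^ l` compensates the `q x` placed in the denominator of the node factor of
`gamma`; over all nodes these factors multiply to `q x ^ t`. -/
theorem integral_power (h : net.IsNakagamiALOHA Pr P S) {x y ν : Fin n} (hxy : x ≠ y) (hν : ν ≠ y)
    (l : ℕ) :
    ∫ ω, P ν y ω ^ l / (l.factorial : ℝ)
        * Real.exp (-(net.shape x * net.mu x y * net.θ * P ν y ω)) ∂Pr
      = net.q x ^ l * (((l + net.shape ν - 1).choose l : ℝ) *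
        ((1 / (net.shape ν * net.q x * net.mu ν y)) ^ l /
          (net.θ * (net.shape x / net.shape ν) * (net.mu x y / net.mu ν y) + 1) ^
            (net.shape ν + l))) := by
  have hq := net.q_pos x
  have hμ := net.mu_pos hν
  have hμx := net.mu_pos hxy
  have hθ := net.θ_pos
  have hs : (0 : ℝ) < net.shape ν := by exact_mod_cast net.shape_pos ν
  have hsub : net.shape ν - 1 + 1 = net.shape ν := Nat.sub_add_cancel (net.shape_pos ν)
  have key := integral_pow_mul_exp_neg_gammaMeasure (j := net.shape ν - 1) (l := l)
    (r := net.shape ν * net.mu ν y) (c := net.shape x * net.mu x y * net.θ)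
    (by positivity) (by positivity)
  rw [hsub, ← h.power_law ν y hν, integral_map (h.measurable_power ν y hν).aemeasurable
    (by fun_prop)] at key
  rw [key, ← Nat.add_sub_assoc (net.shape_pos ν)]
  rw [show net.shape x * net.mu x y * net.θ / (net.shape ν * net.mu ν y) =
    net.θ * (net.shape x / net.shape ν) * (net.mu x y / net.mu ν y) by field_simp]
  rw [show 1 / (net.shape ν * net.mu ν y) = net.q x * (1 / (net.shape ν * net.q x * net.mu ν y)) by
    field_simp, mul_pow]
  ring

/-- Nodes of `J` outside `T` are kept as interferers of power zero. This gives all subsets `T` the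
same index set `J`, so that only `ξ` varies when slots are averaged. -/
theorem measureReal_successSet [IsProbabilityMeasure Pr] (h : net.IsNakagamiALOHA Pr P S)
    {x y : Fin n} (hxy : x ≠ y)
    {T J : Finset (Fin n)} (hTJ : T ⊆ J) (hxJ : x ∉ J) (hyJ : y ∉ J) :
    Pr.real (net.successSet P x y T) = net.gamma x y J fun ν => if ν ∈ T then 1 else 0 := by
  have hq := net.q_pos x
  have hμx := net.mu_pos hxy
  have hθ := net.θ_pos
  have hN := net.noise_pos
  have hs : (0 : ℝ) < net.shape x := by exact_mod_cast net.shape_pos x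
  have hsub : net.shape x - 1 + 1 = net.shape x := Nat.sub_add_cancel (net.shape_pos x)
  have hne : ∀ ν ∈ J, ν ≠ y := fun ν hν => ne_of_mem_of_not_mem hν hyJ
  have hsum : ∀ ω, ∑ ν ∈ J, (if ν ∈ T then (1 : ℝ) else 0) * P ν y ω = ∑ ν ∈ T, P ν y ω := by
    intro ω
    simp only [ite_mul, one_mul, zero_mul]
    rw [Finset.sum_ite_mem, Finset.inter_eq_right.2 hTJ]
  have hset : Pr.real (net.successSet P x y T) = Pr.real {ω | net.θ *
      (net.noise + ∑ ν ∈ J, (if ν ∈ T then (1 : ℝ) else 0) * P ν y ω) ≤ P x y ω} := by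
    -- Clearing the denominator requires nonnegative powers, which hold only almost surely.
    refine measureReal_congr ?_
    filter_upwards [h.ae_nonneg_power] with ω hω
    have h0 : 0 ≤ ∑ ν ∈ T, P ν y ω :=
      Finset.sum_nonneg fun ν hν => hω ν y (hne ν (hTJ hν))
    refine propext ?_
    change net.θ ≤ _ / _ ↔ net.θ * _ ≤ _
    rw [hsum, le_div_iff₀ (by positivity)]
  have hYind : iIndepFun (fun ν : J => fun ω => (if ν.1 ∈ T then (1 : ℝ) else 0) * P ν y ω) Pr := by
    have hinj : Function.Injective fun ν : J =>
        (⟨(ν.1, y), hne ν ν.2⟩ : {p : Fin n × Fin n // p.1 ≠ p.2}) := by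
      intro a b hab
      exact Subtype.ext (congrArg (fun p => p.1.1) hab)
    exact (h.power_indep.precomp hinj).comp
      (fun ν : J => fun z : ℝ => (if ν.1 ∈ T then (1 : ℝ) else 0) * z) fun ν => by fun_prop
  have hind : IndepFun (fun ω => ∑ ν ∈ J, (if ν ∈ T then (1 : ℝ) else 0) * P ν y ω) (P x y) Pr := by
    simp_rw [hsum]
    have hdisj : Disjoint ((fun ν => (ν, y)) '' (T : Set (Fin n))) {(x, y)} := by
      rw [Set.disjoint_singleton_right]
      rintro ⟨ν, hν, hνx⟩
      obtain rfl : ν = x := congrArg Prod.fst hνx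
      exact hxJ (hTJ hν)
    refine indep_of_indep_of_le_left (indep_of_indep_of_le_right (h.indep_powerSigma hdisj) ?_) ?_
    · exact (measurable_powerSigma P hxy (Set.mem_singleton _)).comap_le
    · exact (measurable_sum_powerSigma P (fun hy => hyJ (hTJ hy))
        fun ν hν => Set.mem_image_of_mem _ hν).comap_le
  have hlaw := h.power_law x y hxy
  rw [← hsub] at hlaw
  rw [hset, measureReal_threshold_le_sum
    (Y := fun ν ω => (if ν ∈ T then (1 : ℝ) else 0) * P ν y ω)
    (r := ((net.shape x - 1 + 1 : ℕ) : ℝ) * net.mu x y) (by rw [hsub]; positivity)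
    hθ hN (h.measurable_power x y hxy)
    (fun ν hν => (h.measurable_power ν y (hne ν hν)).const_mul _)
    (fun ν hν => by
      filter_upwards [h.ae_nonneg_power] with ω hω
      have := hω ν y (hne ν hν)
      positivity) hYind hind hlaw, hsub]
  unfold gamma
  rw [show (net.shape x : ℝ) * net.mu x y * net.θ * net.noise
    = net.θ * net.shape x * net.mu x y * net.noise by ring]
  congr 1
  refine Finset.sum_congr rfl fun s _ => ?_
  congr 1
  refine Finset.sum_congr rfl fun t _ => ?_
  rw [show 1 / (net.noise ^ t * ((s - t).factorial : ℝ))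
    = 1 / net.noise ^ t / ((s - t).factorial : ℝ) by field_simp, div_mul_eq_mul_div,
    div_mul_eq_mul_div]
  rw [div_pow, div_mul_eq_mul_div, div_mul_eq_mul_div, one_mul]
  congr 1
  rw [Finset.mul_sum]
  congr 1
  refine Finset.sum_congr rfl fun ℓ hℓ => ?_
  rw [← (Finset.mem_piAntidiag.1 hℓ).1, ← Finset.prod_pow_eq_pow_sum, ← Finset.prod_mul_distrib]
  refine Finset.prod_congr rfl fun ν hν => ?_
  by_cases hνT : ν ∈ T
  · simp only [hνT, if_true, one_mul, sub_self, zero_mul, zero_add]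
    exact h.integral_power hxy (hne ν hν) (ℓ ν)
  -- For a silent node the integrand is the constant `0 ^ ℓ ν / (ℓ ν)!`, which is the Kronecker
  -- delta.
  · by_cases hl : ℓ ν = 0 <;> simp [hνT, hl]

end IsNakagamiALOHA

/-! ### Conditioning on the slot choices; joint success of two links. -/

/-- The interferers of the link from `i` to `j` under the slot choice `s`. -/
def interferers {m : ℕ} (s : Fin n → Fin m) (i j : Fin n) : Finset (Fin n) :=
  (Finset.univ \ {i, j}).filter fun ν => s ν = s i

theorem mem_interferers {m : ℕ} {s : Fin n → Fin m} {i j ν : Fin n} :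
    ν ∈ interferers s i j ↔ (ν ≠ i ∧ ν ≠ j) ∧ s ν = s i := by
  simp [interferers]

/-- Outside the slot of `i` the ratio is `0 < θ`, so a single summand survives. -/
theorem X_eq_indicator (net : Network n) {Ω : Type*} (P : Fin n → Fin n → Ω → ℝ)
    (S : Fin n → Ω → Fin net.slots) (i j : Fin n) :
    net.X P S i j = {ω | ω ∈ net.successSet P i j (interferers (fun a => S a ω) i j)}.indicator 1 := by
  classical
  ext ω
  unfold X
  rw [Finset.sum_eq_single (S i ω)]
  · simp only [slotSuccess, slotPower, interference, Set.indicator_apply, successSet,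
      Set.mem_ofPred_eq, if_true, interferers, Finset.sum_filter, Pi.one_apply]
  · intro k _ hk
    have : ¬ net.θ ≤ 0 := not_le.2 net.θ_pos
    simp [slotSuccess, slotPower, hk.symm, this]
  · simp

theorem setOf_mem_eq_iUnion {Ω : Type*} {m : ℕ} (S : Fin n → Ω → Fin m)
    (B : (Fin n → Fin m) → Set Ω) :
    {ω | ω ∈ B fun i => S i ω} = ⋃ s, {ω | (fun i => S i ω) = s} ∩ B s := by
  ext ω
  simp

namespace IsNakagamiALOHA

variable {net : Network n} {Ω : Type*} [MeasurableSpace Ω] {Pr : Measure Ω}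
  {P : Fin n → Fin n → Ω → ℝ} {S : Fin n → Ω → Fin net.slots}

theorem measurableSet_successSet (h : net.IsNakagamiALOHA Pr P S) {x y : Fin n}
    {T : Finset (Fin n)} (hxy : x ≠ y) (hyT : y ∉ T) :
    MeasurableSet (net.successSet P x y T) :=
  h.powerSigma_le Set.univ _ (Network.measurableSet_successSet net P hxy hyT (Set.mem_univ _)
    fun _ _ => Set.mem_univ _)

theorem measureReal_slot_eq [IsProbabilityMeasure Pr] (h : net.IsNakagamiALOHA Pr P S)
    (s : Fin n → Fin net.slots) :
    Pr.real {ω | (fun i => S i ω) = s} = (1 / (net.slots : ℝ)) ^ n := by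
  have : {ω | (fun i => S i ω) = s} = ⋂ i, S i ⁻¹' {s i} := by
    ext ω
    simp [funext_iff]
  rw [this, measureReal_def, h.slot_indep.meas_iInter fun i =>
    ⟨{s i}, MeasurableSet.singleton _, rfl⟩, ENNReal.toReal_prod]
  have hs : ∀ i, (Pr (S i ⁻¹' {s i})).toReal = 1 / net.slots := fun i => h.slot_uniform i (s i)
  simp [hs]

theorem measurableSet_slot_eq (h : net.IsNakagamiALOHA Pr P S) (s : Fin n → Fin net.slots) :
    MeasurableSet {ω | (fun i => S i ω) = s} :=
  (measurable_pi_lambda _ h.measurable_slot) (MeasurableSet.singleton s)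

theorem measurableSet_setOf_mem (h : net.IsNakagamiALOHA Pr P S)
    {B : (Fin n → Fin net.slots) → Set Ω} (hB : ∀ s, MeasurableSet (B s)) :
    MeasurableSet {ω | ω ∈ B fun i => S i ω} := by
  rw [setOf_mem_eq_iUnion]
  exact MeasurableSet.iUnion fun s => (h.measurableSet_slot_eq s).inter (hB s)

theorem measureReal_setOf_mem [IsProbabilityMeasure Pr] (h : net.IsNakagamiALOHA Pr P S)
    {B : (Fin n → Fin net.slots) → Set Ω} (hB : ∀ s, MeasurableSet[powerSigma P Set.univ] (B s)) :
    Pr.real {ω | ω ∈ B fun i => S i ω} = (∑ s, Pr.real (B s)) / (net.slots : ℝ) ^ n := by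
  have hind : Indep (powerSigma P Set.univ)
      (MeasurableSpace.comap (fun ω i => S i ω) inferInstance) Pr := by
    refine indep_of_indep_of_le_left h.power_indep_slot (iSup₂_le fun p _ => ?_)
    rintro _ ⟨A, hA, rfl⟩
    exact ⟨(fun f => f p) ⁻¹' A, measurable_pi_apply p hA, rfl⟩
  rw [setOf_mem_eq_iUnion, measureReal_iUnion_fintype, Finset.sum_div]
  · refine Finset.sum_congr rfl fun s _ => ?_
    have hprod : Pr (B s ∩ {ω | (fun i => S i ω) = s})
        = Pr (B s) * Pr {ω | (fun i => S i ω) = s} :=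
      (Indep_iff _ _ _).1 hind _ _ (hB s) ⟨{s}, MeasurableSet.singleton s, rfl⟩
    rw [Set.inter_comm, measureReal_def, hprod, ENNReal.toReal_mul, ← measureReal_def,
      ← measureReal_def, h.measureReal_slot_eq, one_div, inv_pow, div_eq_mul_inv]
  · intro s t hst
    refine Set.disjoint_left.2 fun ω hs ht => hst ?_
    exact hs.1.symm.trans ht.1
  · exact fun s => (h.measurableSet_slot_eq s).inter (h.powerSigma_le _ _ (hB s))

theorem integral_X [IsProbabilityMeasure Pr] (h : net.IsNakagamiALOHA Pr P S) {i j : Fin n}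
    (hij : i ≠ j) :
    ∫ ω, net.X P S i j ω ∂Pr
      = (∑ s : Fin n → Fin net.slots, Pr.real (net.successSet P i j (interferers s i j)))
        / (net.slots : ℝ) ^ n := by
  have hj : ∀ s : Fin n → Fin net.slots, j ∉ interferers s i j := fun s hs =>
    (mem_interferers.1 hs).1.2 rfl
  rw [X_eq_indicator, integral_indicator_one (h.measurableSet_setOf_mem
    (B := fun s => net.successSet P i j (interferers s i j))
    fun s => h.measurableSet_successSet hij (hj s))]
  exact h.measureReal_setOf_mem (B := fun s => net.successSet P i j (interferers s i j)) fun s =>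
    Network.measurableSet_successSet net P hij (hj s) (Set.mem_univ _) fun _ _ => Set.mem_univ _

theorem covariance_X [IsProbabilityMeasure Pr] (h : net.IsNakagamiALOHA Pr P S) {i j k l : Fin n}
    (hij : i ≠ j) (hkl : k ≠ l) :
    cov[net.X P S i j, net.X P S k l; Pr]
      = (∑ s : Fin n → Fin net.slots, Pr.real (net.successSet P i j (interferers s i j) ∩
          net.successSet P k l (interferers s k l))) / (net.slots : ℝ) ^ n
        - (∫ ω, net.X P S i j ω ∂Pr) * ∫ ω, net.X P S k l ω ∂Pr := by
  have hj : ∀ (i j : Fin n) (s : Fin n → Fin net.slots), j ∉ interferers s i j := fun _ _ s hs =>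
    (mem_interferers.1 hs).1.2 rfl
  have hm : ∀ i j : Fin n, i ≠ j → MeasurableSet
      {ω | ω ∈ net.successSet P i j (interferers (fun a => S a ω) i j)} := fun i j hij =>
    h.measurableSet_setOf_mem (B := fun s => net.successSet P i j (interferers s i j))
      fun s => h.measurableSet_successSet hij (hj i j s)
  have hL : ∀ i j : Fin n, i ≠ j → MemLp (net.X P S i j) 2 Pr := fun i j hij => by
    rw [X_eq_indicator]
    exact memLp_indicator_const 2 (hm i j hij) 1 (Or.inr (measure_ne_top _ _))
  rw [covariance_eq_sub (hL i j hij) (hL k l hkl)]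
  congr 1
  rw [X_eq_indicator, X_eq_indicator, ← Set.inter_indicator_one,
    integral_indicator_one ((hm i j hij).inter (hm k l hkl))]
  exact h.measureReal_setOf_mem (B := fun s => net.successSet P i j (interferers s i j) ∩
    net.successSet P k l (interferers s k l)) fun s =>
    MeasurableSet.inter
      (Network.measurableSet_successSet net P hij (hj i j s) (Set.mem_univ _)
        fun _ _ => Set.mem_univ _)
      (Network.measurableSet_successSet net P hkl (hj k l s) (Set.mem_univ _)
        fun _ _ => Set.mem_univ _)

/-- Each event is determined by powers arriving at its own receiver. A common power would require `j
= l` and a node active in both links. -/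
theorem measureReal_successSet_inter [IsProbabilityMeasure Pr] (h : net.IsNakagamiALOHA Pr P S)
    {i j k l : Fin n} {T T' : Finset (Fin n)} (hij : i ≠ j) (hkl : k ≠ l) (hT : j ∉ T)
    (hT' : l ∉ T') (hdisj : j = l → Disjoint (insert i T) (insert k T')) :
    Pr.real (net.successSet P i j T ∩ net.successSet P k l T')
      = Pr.real (net.successSet P i j T) * Pr.real (net.successSet P k l T') := by
  have hUV : Disjoint ((fun ν => (ν, j)) '' (insert i T : Set (Fin n)))
      ((fun ν => (ν, l)) '' (insert k T' : Set (Fin n))) := by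
    refine Set.disjoint_left.2 ?_
    rintro _ ⟨a, ha, rfl⟩ ⟨b, hb, hab⟩
    obtain ⟨rfl, rfl⟩ := Prod.ext_iff.1 hab
    exact Finset.disjoint_left.1 (hdisj rfl) (by simpa using ha) (by simpa using hb)
  rw [measureReal_def, (Indep_iff _ _ _).1 (h.indep_powerSigma hUV) _ _
    (Network.measurableSet_successSet net P hij hT
      (Set.mem_image_of_mem (fun ν => (ν, j)) (Set.mem_insert _ _))
      fun ν hν => Set.mem_image_of_mem (fun ν => (ν, j)) (Set.mem_insert_of_mem _ hν))
    (Network.measurableSet_successSet net P hkl hT'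
      (Set.mem_image_of_mem (fun ν => (ν, l)) (Set.mem_insert _ _))
      fun ν hν => Set.mem_image_of_mem (fun ν => (ν, l)) (Set.mem_insert_of_mem _ hν)),
    ENNReal.toReal_mul, ← measureReal_def, ← measureReal_def]

/-- As `θ ≥ 1` and `N > 0`, success makes the signal strictly stronger than every interferer. Two
mutually interfering transmitters would each have to be stronger than the other. -/
theorem measureReal_successSet_inter_eq_zero (h : net.IsNakagamiALOHA Pr P S)
    {i j k : Fin n} {T T' : Finset (Fin n)} (hT : j ∉ T) (hT' : j ∉ T') (hk : k ∈ T) (hi : i ∈ T') :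
    Pr.real (net.successSet P i j T ∩ net.successSet P k j T') = 0 := by
  have hN := net.noise_pos
  have key : ∀ (ω : Ω) (i k : Fin n) (T : Finset (Fin n)), (∀ i j : Fin n, i ≠ j → 0 ≤ P i j ω) →
      j ∉ T → k ∈ T → ω ∈ net.successSet P i j T → P k j ω < P i j ω := by
    intro ω i k T hω hT hk hs
    have h0 : ∀ ν ∈ T, 0 ≤ P ν j ω := fun ν hν => hω ν j (ne_of_mem_of_not_mem hν hT)
    have h1 : P k j ω ≤ ∑ ν ∈ T, P ν j ω := Finset.single_le_sum h0 hk
    have h2 := h0 k hk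
    have h3 : net.θ * (net.noise + ∑ ν ∈ T, P ν j ω) ≤ P i j ω :=
      (le_div_iff₀ (by linarith)).1 hs
    nlinarith [net.one_le_θ]
  rw [measureReal_def, measure_eq_zero_iff_ae_notMem.2, ENNReal.toReal_zero]
  filter_upwards [h.ae_nonneg_power] with ω hω hmem
  exact lt_asymm (key ω i k T hω hT hk hmem.1) (key ω k i T' hω hT' hi hmem.2)

end IsNakagamiALOHA

/-! ### Averaging over slot vectors and counting macro states. -/

theorem gamma_congr (net : Network n) {x y : Fin n} {J : Finset (Fin n)} {ξ ξ' : Fin n → ℝ}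
    (h : ∀ ν ∈ J, ξ ν = ξ' ν) : net.gamma x y J ξ = net.gamma x y J ξ' := by
  unfold gamma
  congr! 6 with s _ t _ ℓ _
  exact Finset.prod_congr rfl fun ν hν => by rw [h ν hν]

/-- Fix the slot of `i`. The other slots vary freely, so the sum factors over nodes, and an affine
factor averages to its value at `1 / m`. That `i ∉ J` keeps the factor of `i` equal to `1`. -/
theorem sum_prod_affine_slots {m : ℕ} (hm : 0 < m) {J : Finset (Fin n)} {i : Fin n}
    (hi : i ∉ J) (a b : Fin n → ℝ) :
    ∑ s : Fin n → Fin m, ∏ ν ∈ J, ((1 - if s ν = s i then (1 : ℝ) else 0) * a ν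
        + (if s ν = s i then (1 : ℝ) else 0) * b ν)
      = (m : ℝ) ^ n * ∏ ν ∈ J, ((1 - 1 / (m : ℝ)) * a ν + 1 / (m : ℝ) * b ν) := by
  have hm' : (m : ℝ) ≠ 0 := by exact_mod_cast hm.ne'
  have inner : ∀ κ : Fin m, (∑ s : Fin n → Fin m with s i = κ,
      ∏ ν ∈ J, ((1 - if s ν = s i then (1 : ℝ) else 0) * a ν
        + (if s ν = s i then (1 : ℝ) else 0) * b ν))
      = (m : ℝ) ^ (n - 1) * ∏ ν ∈ J, ((1 - 1 / (m : ℝ)) * a ν + 1 / (m : ℝ) * b ν) := by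
    intro κ
    have hset : (Finset.univ.filter fun s : Fin n → Fin m => s i = κ)
        = Fintype.piFinset fun ν => if ν = i then {κ} else Finset.univ := by
      ext s
      simp only [Finset.mem_filter, Finset.mem_univ, true_and, Fintype.mem_piFinset]
      refine ⟨fun h ν => ?_, fun h => by simpa using h i⟩
      by_cases hν : ν = i
      · subst hν; simp [h]
      · simp [hν]
    have hterm : ∀ s ∈ Fintype.piFinset (fun ν => if ν = i then {κ} else Finset.univ),
        (∏ ν ∈ J, ((1 - if s ν = s i then (1 : ℝ) else 0) * a ν
          + (if s ν = s i then (1 : ℝ) else 0) * b ν))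
        = ∏ ν, if ν ∈ J then ((1 - if s ν = κ then (1 : ℝ) else 0) * a ν
          + (if s ν = κ then (1 : ℝ) else 0) * b ν) else 1 := by
      intro s hs
      have : s i = κ := by rw [← hset] at hs; simpa using hs
      rw [Finset.prod_ite_mem, Finset.univ_inter, this]
    rw [hset, Finset.sum_congr rfl hterm, ← Finset.prod_univ_sum (f := fun ν z =>
      if ν ∈ J then ((1 - if z = κ then (1 : ℝ) else 0) * a ν
          + (if z = κ then (1 : ℝ) else 0) * b ν) else 1)]
    have hfac : ∀ ν, (∑ z ∈ if ν = i then {κ} else Finset.univ,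
        if ν ∈ J then ((1 - if z = κ then (1 : ℝ) else 0) * a ν
          + (if z = κ then (1 : ℝ) else 0) * b ν) else 1)
        = (if ν = i then 1 else (m : ℝ)) *
          if ν ∈ J then ((1 - 1 / (m : ℝ)) * a ν + 1 / (m : ℝ) * b ν) else 1 := by
      intro ν
      by_cases hν : ν = i
      · subst hν; simp [hi]
      · by_cases hJ : ν ∈ J
        · simp only [hν, hJ, if_false, if_true, Finset.sum_add_distrib, ← Finset.sum_mul,
            Finset.sum_sub_distrib, Finset.sum_ite_eq', Finset.mem_univ, Finset.sum_const,
            Finset.card_univ, Fintype.card_fin, nsmul_eq_mul, mul_one]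
          field_simp
        · simp [hν, hJ]
    rw [Finset.prod_congr rfl fun ν _ => hfac ν, Finset.prod_mul_distrib, Finset.prod_ite_mem,
      Finset.univ_inter, Finset.prod_ite, Finset.prod_const_one, one_mul, Finset.prod_const,
      Finset.filter_ne', Finset.card_erase_of_mem (Finset.mem_univ _), Finset.card_univ,
      Fintype.card_fin]
  have hn : n - 1 + 1 = n := Nat.sub_add_cancel (Nat.one_le_of_lt i.2)
  rw [← Finset.sum_fiberwise Finset.univ fun s : Fin n → Fin m => s i,
    Finset.sum_congr rfl fun κ _ => inner κ, Finset.sum_const, Finset.card_univ, Fintype.card_fin,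
    nsmul_eq_mul, ← mul_assoc, ← pow_succ', hn]

theorem sum_gamma_slots (net : Network n) {x y i : Fin n} {J : Finset (Fin n)} (hi : i ∉ J) :
    ∑ s : Fin n → Fin net.slots, net.gamma x y J (fun ν => if s ν = s i then 1 else 0)
      = (net.slots : ℝ) ^ n * net.gamma x y J fun _ => 1 / (net.slots : ℝ) := by
  unfold gamma
  rw [← Finset.mul_sum, mul_left_comm]
  congr 1
  rw [Finset.sum_comm, Finset.mul_sum]
  refine Finset.sum_congr rfl fun s _ => ?_
  rw [← Finset.mul_sum, mul_left_comm]
  congr 1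
  rw [Finset.sum_comm, Finset.mul_sum]
  refine Finset.sum_congr rfl fun t _ => ?_
  rw [← Finset.mul_sum, mul_left_comm]
  congr 1
  rw [Finset.sum_comm, Finset.mul_sum]
  refine Finset.sum_congr rfl fun ℓ _ => ?_
  have h := sum_prod_affine_slots net.slots_pos hi (fun ν => if ℓ ν = 0 then (1 : ℝ) else 0)
    (fun ν => ((ℓ ν + net.shape ν - 1).choose (ℓ ν) : ℝ) *
              ((1 / (net.shape ν * net.q x * net.mu ν y)) ^ ℓ ν /
                (net.θ * (net.shape x / net.shape ν) * (net.mu x y / net.mu ν y) + 1) ^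
                  (net.shape ν + ℓ ν)))
  simpa only [mul_left_comm, mul_div_assoc] using h

/-- Summation over slot choices, fixed outside `J`, grouped by the classes of the nodes in `J`. -/
theorem sum_slots_eq_sum_macroStates {m r : ℕ} (J : Finset (Fin n)) {cls : Fin m → ℕ}
    (hcls : ∀ a, cls a < r) (g : Fin n → Fin m) (F : (Fin n → ℕ) → ℝ) :
    (∑ s : Fin n → Fin m with ∀ ν ∉ J, s ν = g ν, F fun ν => if ν ∈ J then cls (s ν) else 0)
      = ∑ c ∈ macroStates J r,
          (∏ ν ∈ J, ((Finset.univ.filter fun a => cls a = c ν).card : ℝ)) * F c := by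
  rw [← Finset.sum_fiberwise_of_maps_to (t := macroStates J r)
    (g := fun (s : Fin n → Fin m) ν => if ν ∈ J then cls (s ν) else 0)]
  · refine Finset.sum_congr rfl fun c hc => ?_
    have hcJ : ∀ ν ∉ J, c ν = 0 := fun ν hν => by
      have := Fintype.mem_piFinset.1 hc ν
      simpa [hν] using this
    rw [Finset.sum_congr rfl (g := fun _ => F c) fun s hs => by
      rw [(Finset.mem_filter.1 hs).2], Finset.sum_const, nsmul_eq_mul]
    congr 1
    -- The fibre over `c` is a box: a node of `J` takes any slot of class `c ν`, every other node is
    -- pinned to `g ν`.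
    have hset : ((Finset.univ.filter fun s : Fin n → Fin m => ∀ ν ∉ J, s ν = g ν).filter
        fun s => (fun ν => if ν ∈ J then cls (s ν) else 0) = c)
        = Fintype.piFinset fun ν =>
          if ν ∈ J then Finset.univ.filter fun a => cls a = c ν else {g ν} := by
      ext s
      simp only [Finset.mem_filter, Finset.mem_univ, true_and, Fintype.mem_piFinset, funext_iff]
      rw [← forall_and]
      refine forall_congr' fun ν => ?_
      by_cases hν : ν ∈ J
      · simp [hν]
      · simp [hν, hcJ ν hν]
    rw [hset, Fintype.card_piFinset, Nat.cast_prod, ← Finset.prod_subset (Finset.subset_univ J)]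
    · exact Finset.prod_congr rfl fun ν hν => by rw [if_pos hν]
    · intro ν _ hν
      simp [hν]
  · intro s _
    refine Fintype.mem_piFinset.2 fun ν => ?_
    by_cases hν : ν ∈ J
    · simp [hν, hcls]
    · simp [hν]

/-- Class `1` is the slot `κ` alone; class `0` is the other `m - 1` slots. -/
theorem prod_card_eq_phi (net : Network n) (J : Finset (Fin n)) (κ : Fin net.slots)
    {c : Fin n → ℕ} (hc : c ∈ macroStates J 2) :
    (∏ ν ∈ J, ((Finset.univ.filter fun a => (if a = κ then 1 else 0) = c ν).card : ℝ))
      = net.phi J c := by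
  refine Finset.prod_congr rfl fun ν hν => ?_
  have h2 : c ν < 2 := by simpa [hν] using Fintype.mem_piFinset.1 hc ν
  interval_cases c ν
  · have : (Finset.univ.filter fun a => (if a = κ then 1 else 0) = 0) = Finset.univ.erase κ := by
      ext a; simp
    rw [this, Finset.card_erase_of_mem (Finset.mem_univ _), Finset.card_univ, Fintype.card_fin,
      Nat.cast_pred net.slots_pos]
    simp
  · have : (Finset.univ.filter fun a => (if a = κ then 1 else 0) = 1) = {κ} := by
      ext a; simp
    rw [this]
    simp

theorem prod_card_eq_psi (net : Network n) (J : Finset (Fin n)) {κ κ' : Fin net.slots}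
    (hκ : κ ≠ κ') {c : Fin n → ℕ} (hc : c ∈ macroStates J 3) :
    (∏ ν ∈ J, ((Finset.univ.filter fun a =>
      (if a = κ then 1 else if a = κ' then 2 else 0) = c ν).card : ℝ)) = net.psi J c := by
  refine Finset.prod_congr rfl fun ν hν => ?_
  have h3 : c ν < 3 := by simpa [hν] using Fintype.mem_piFinset.1 hc ν
  interval_cases c ν
  · have : (Finset.univ.filter fun a => (if a = κ then 1 else if a = κ' then 2 else 0) = 0)
        = Finset.univ \ {κ, κ'} := by
      ext a
      simp only [Finset.mem_filter, Finset.mem_univ, true_and, Finset.mem_sdiff,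
        Finset.mem_insert, Finset.mem_singleton]
      split_ifs <;> simp_all
    -- Two distinct slots force `m ≥ 2`, so the natural subtraction `m - 2` casts faithfully.
    have h2 : 2 ≤ net.slots := by
      have := Finset.card_le_univ {κ, κ'}
      rwa [Finset.card_pair hκ, Fintype.card_fin] at this
    rw [this, Finset.card_sdiff_of_subset (Finset.subset_univ _), Finset.card_pair hκ,
      Finset.card_univ, Fintype.card_fin, Nat.cast_sub h2]
    simp
  · have : (Finset.univ.filter fun a => (if a = κ then 1 else if a = κ' then 2 else 0) = 1)
        = {κ} := by
      ext a
      simp only [Finset.mem_filter, Finset.mem_univ, true_and, Finset.mem_singleton]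
      split_ifs <;> simp_all
    rw [this]
    simp
  · have : (Finset.univ.filter fun a => (if a = κ then 1 else if a = κ' then 2 else 0) = 2)
        = {κ'} := by
      ext a
      simp only [Finset.mem_filter, Finset.mem_univ, true_and, Finset.mem_singleton]
      split_ifs <;> simp_all
    rw [this]
    simp

/-! ### State coefficients as success probabilities. -/

theorem alpha_eq_measureReal_successSet (net : Network n) {Ω : Type*} [MeasurableSpace Ω]
    {Pr : Measure Ω} {P : Fin n → Fin n → Ω → ℝ} {x y z : Fin n} {c : Fin n → ℕ}
    (hc : ∀ ν, c ν < 2) :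
    net.alpha Pr P x y z c = Pr.real (net.successSet P x y
      ((Finset.univ \ {x, y}).filter fun ν => ν = z ∨ c ν = 1)) := by
  unfold alpha successSet
  have hsum : ∀ ω, (∑ ν ∈ Finset.univ \ {x, y, z}, (c ν : ℝ) * P ν y ω
      + if z = x ∨ z = y then 0 else P z y ω)
      = ∑ ν ∈ (Finset.univ \ {x, y}).filter (fun ν => ν = z ∨ c ν = 1), P ν y ω := by
    intro ω
    have hterm : ∀ ν ∈ Finset.univ \ {x, y, z}, (c ν : ℝ) * P ν y ω
        = if ν = z ∨ c ν = 1 then P ν y ω else 0 := by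
      intro ν hν
      have hz : ν ≠ z := by rintro rfl; simp at hν
      have h2 := hc ν
      interval_cases c ν <;> simp [hz]
    rw [Finset.sum_congr rfl hterm, Finset.sum_filter]
    -- If `z` is the transmitter or the receiver, excluding it again changes nothing and the extra
    -- summand is zero; otherwise that summand restores `z` as an interferer.
    by_cases hz : z = x ∨ z = y
    · have : (Finset.univ \ {x, y, z} : Finset (Fin n)) = Finset.univ \ {x, y} := by
        ext ν; simp only [Finset.mem_sdiff, Finset.mem_univ, Finset.mem_insert,
          Finset.mem_singleton, true_and]; grind
      rw [this, if_pos hz, add_zero]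
    · have hins : (Finset.univ \ {x, y} : Finset (Fin n)) = insert z (Finset.univ \ {x, y, z}) := by
        ext ν; simp only [Finset.mem_sdiff, Finset.mem_univ, Finset.mem_insert,
          Finset.mem_singleton, true_and]; grind
      rw [hins, Finset.sum_insert (by simp), if_neg hz, add_comm]
      simp
  simp_rw [add_assoc, hsum]

theorem beta_eq_measureReal_successSet (net : Network n) {Ω : Type*} [MeasurableSpace Ω]
    {Pr : Measure Ω} {P : Fin n → Fin n → Ω → ℝ} {x y z : Fin n} {c : Fin n → ℕ} (d : ℕ) :
    net.beta Pr P d x y z c = Pr.real (net.successSet P x y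
      ((Finset.univ \ {x, y, z}).filter fun ν => c ν = d)) := by
  unfold beta successSet
  simp only [ite_mul, one_mul, zero_mul, Finset.sum_filter]

theorem lt_of_mem_macroStates {J : Finset (Fin n)} {r : ℕ} (hr : 0 < r) {c : Fin n → ℕ}
    (hc : c ∈ macroStates J r) (ν : Fin n) : c ν < r := by
  have := Fintype.mem_piFinset.1 hc ν
  by_cases hν : ν ∈ J
  · simpa [hν] using this
  · simp only [hν, if_false, Finset.mem_singleton] at this
    omega

theorem alphaClosed_self (net : Network n) (x y : Fin n) (c : Fin n → ℕ) :
    net.alphaClosed x y x c = net.alphaSame x y c :=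
  net.gamma_congr fun ν hν => if_neg fun hx => by simp [hx] at hν

/-! ### Closed forms for the expectation and the covariances. -/

namespace IsNakagamiALOHA

variable {net : Network n} {Ω : Type*} [MeasurableSpace Ω] {Pr : Measure Ω}
  [IsProbabilityMeasure Pr] {P : Fin n → Fin n → Ω → ℝ} {S : Fin n → Ω → Fin net.slots}

theorem measureReal_successSet_eq_gamma (h : net.IsNakagamiALOHA Pr P S) {x y : Fin n}
    (hxy : x ≠ y) {T J : Finset (Fin n)} {ξ : Fin n → ℝ} (hTJ : T ⊆ J) (hxJ : x ∉ J) (hyJ : y ∉ J)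
    (hξ : ∀ ν ∈ J, ξ ν = if ν ∈ T then 1 else 0) :
    Pr.real (net.successSet P x y T) = net.gamma x y J ξ := by
  rw [h.measureReal_successSet hxy hTJ hxJ hyJ]
  exact net.gamma_congr fun ν hν => (hξ ν hν).symm

theorem integral_X_eq_gamma (h : net.IsNakagamiALOHA Pr P S) {i j : Fin n} (hij : i ≠ j) :
    ∫ ω, net.X P S i j ω ∂Pr
      = net.gamma i j (Finset.univ \ {i, j}) fun _ => 1 / (net.slots : ℝ) := by
  rw [h.integral_X hij, Finset.sum_congr rfl fun s _ =>
    h.measureReal_successSet_eq_gamma hij (J := Finset.univ \ {i, j})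
      (ξ := fun ν => if s ν = s i then 1 else 0) (Finset.filter_subset _ _) (by simp) (by simp)
      (fun ν hν => by simp [hν]), net.sum_gamma_slots (by simp)]
  have := net.slots_pos_real
  field_simp

theorem alpha_eq_alphaClosed (h : net.IsNakagamiALOHA Pr P S) {x y z : Fin n} (hxy : x ≠ y)
    {c : Fin n → ℕ} (hc : ∀ ν, c ν < 2) : net.alpha Pr P x y z c = net.alphaClosed x y z c := by
  rw [net.alpha_eq_measureReal_successSet hc]
  refine h.measureReal_successSet_eq_gamma hxy (Finset.filter_subset _ _) (by simp) (by simp)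
    fun ν hν => ?_
  have h2 := hc ν
  simp only [Finset.mem_filter, hν, true_and]
  by_cases hz : ν = z
  · simp [hz]
  · interval_cases c ν <;> simp [hz]

theorem beta_eq_betaClosed (h : net.IsNakagamiALOHA Pr P S) {x y z : Fin n} (hxy : x ≠ y) (d : ℕ)
    (c : Fin n → ℕ) : net.beta Pr P d x y z c = net.betaClosed d x y z c := by
  rw [net.beta_eq_measureReal_successSet]
  exact h.measureReal_successSet_eq_gamma hxy (Finset.filter_subset _ _) (by simp) (by simp)
    fun ν hν => by simp [hν]

theorem sum_same_transmitter (h : net.IsNakagamiALOHA Pr P S) {i j l : Fin n} (hij : i ≠ j)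
    (hil : i ≠ l) (hjl : j ≠ l) (κ : Fin net.slots) :
    (∑ s : Fin n → Fin net.slots with s i = κ, Pr.real (net.successSet P i j (interferers s i j) ∩
      net.successSet P i l (interferers s i l)))
      = Phi (Finset.univ \ {i}) (net.phi (Finset.univ \ {i}))
            (fun x y _ c => net.alphaSame x y c) i j i l := by
  have hfilter : (Finset.univ.filter fun s : Fin n → Fin net.slots => s i = κ)
      = Finset.univ.filter fun s : Fin n → Fin net.slots =>
        ∀ ν ∉ Finset.univ \ {i}, s ν = (fun _ => κ) ν := by
    ext s; simp
  have hcls : ∀ a : Fin net.slots, (if a = κ then 1 else 0) < 2 := fun a => by split_ifs <;> simp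
  have hmac := sum_slots_eq_sum_macroStates (Finset.univ \ {i}) hcls (fun _ => κ)
    fun c => net.alphaSame i j c * net.alphaSame i l c
  unfold Phi
  rw [Finset.sum_congr rfl (g := fun c => (∏ ν ∈ Finset.univ \ {i},
    ((Finset.univ.filter fun a => (if a = κ then 1 else 0) = c ν).card : ℝ)) *
      (net.alphaSame i j c * net.alphaSame i l c)) fun c hc => by
    rw [net.prod_card_eq_phi _ κ hc, mul_assoc], ← hmac, ← hfilter]
  refine Finset.sum_congr rfl fun s hs => ?_
  have hsi : s i = κ := (Finset.mem_filter.1 hs).2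
  have key : ∀ j, i ≠ j → Pr.real (net.successSet P i j (interferers s i j)) = net.alphaSame i j
      fun ν => if ν ∈ Finset.univ \ {i} then if s ν = κ then 1 else 0 else 0 := fun j hij =>
    h.measureReal_successSet_eq_gamma hij (Finset.filter_subset _ _) (by simp) (by simp)
      fun ν hν => by
        have : ν ≠ i := by rintro rfl; simp at hν
        simp [interferers, hν, hsi, this]
  rw [h.measureReal_successSet_inter hij hil (by simp [interferers]) (by simp [interferers])
    fun hh => absurd hh hjl, key j hij, key l hil]

/-- Each transmitter interferes with the other link unless it is that link's receiver, which is why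
`alphaClosed` sets `ξ` to `1` there. For a common receiver the joint success is null. -/
theorem sum_same_slot (h : net.IsNakagamiALOHA Pr P S) {i j k l : Fin n} (hij : i ≠ j)
    (hkl : k ≠ l) (hik : i ≠ k) (κ : Fin net.slots) :
    (∑ s : Fin n → Fin net.slots with s i = κ ∧ s k = κ,
      Pr.real (net.successSet P i j (interferers s i j) ∩
        net.successSet P k l (interferers s k l)))
      = (if l = j then 0 else 1) * Phi (Finset.univ \ {i, k}) (net.phi (Finset.univ \ {i, k}))
          net.alphaClosed i j k l := by
  by_cases hlj : l = j
  · subst hlj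
    rw [if_pos rfl, zero_mul]
    refine Finset.sum_eq_zero fun s hs => ?_
    obtain ⟨hsi, hsk⟩ := (Finset.mem_filter.1 hs).2
    refine h.measureReal_successSet_inter_eq_zero (by simp [interferers]) (by simp [interferers])
      ?_ ?_
    · exact mem_interferers.2 ⟨⟨hik.symm, hkl⟩, hsk.trans hsi.symm⟩
    · exact mem_interferers.2 ⟨⟨hik, hij⟩, hsi.trans hsk.symm⟩
  rw [if_neg hlj, one_mul]
  have hfilter : (Finset.univ.filter fun s : Fin n → Fin net.slots => s i = κ ∧ s k = κ)
      = Finset.univ.filter fun s : Fin n → Fin net.slots =>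
        ∀ ν ∉ Finset.univ \ {i, k}, s ν = (fun _ => κ) ν := by
    ext s
    simp only [Finset.mem_filter, Finset.mem_univ, true_and, Finset.mem_sdiff, not_not,
      Finset.mem_insert, Finset.mem_singleton, forall_eq_or_imp, forall_eq]
  have hcls : ∀ a : Fin net.slots, (if a = κ then 1 else 0) < 2 := fun a => by split_ifs <;> simp
  have hmac := sum_slots_eq_sum_macroStates (Finset.univ \ {i, k}) hcls (fun _ => κ)
    fun c => net.alphaClosed i j k c * net.alphaClosed k l i c
  unfold Phi
  rw [Finset.sum_congr rfl (g := fun c => (∏ ν ∈ Finset.univ \ {i, k},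
    ((Finset.univ.filter fun a => (if a = κ then 1 else 0) = c ν).card : ℝ)) *
      (net.alphaClosed i j k c * net.alphaClosed k l i c)) fun c hc => by
    rw [net.prod_card_eq_phi _ κ hc, mul_assoc], ← hmac, ← hfilter]
  refine Finset.sum_congr rfl fun s hs => ?_
  obtain ⟨hsi, hsk⟩ := (Finset.mem_filter.1 hs).2
  rw [h.measureReal_successSet_inter hij hkl (by simp [interferers]) (by simp [interferers])
    fun hh => absurd hh.symm hlj]
  congr 1
  · refine h.measureReal_successSet_eq_gamma hij (Finset.filter_subset _ _) (by simp) (by simp)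
      fun ν hν => ?_
    have : ν ≠ i := by rintro rfl; simp at hν
    by_cases hνk : ν = k
    · subst hνk
      simp [interferers, hν, hsi, hsk]
    · simp [interferers, hν, hsi, this, hνk]
  · refine h.measureReal_successSet_eq_gamma hkl (Finset.filter_subset _ _) (by simp) (by simp)
      fun ν hν => ?_
    have : ν ≠ k := by rintro rfl; simp at hν
    by_cases hνi : ν = i
    · subst hνi
      simp [interferers, hν, hsi, hsk]
    · simp [interferers, hν, hsk, this, hνi]

/-- The active nodes of the two links use different slots and are therefore disjoint, so the events
are independent even for `j = l`. Neither transmitter interferes with the other link. -/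
theorem sum_different_slots (h : net.IsNakagamiALOHA Pr P S) {i j k l : Fin n} (hij : i ≠ j)
    (hkl : k ≠ l) (hik : i ≠ k) {κ κ' : Fin net.slots} (hκ : κ ≠ κ') :
    (∑ s : Fin n → Fin net.slots with s i = κ ∧ s k = κ',
      Pr.real (net.successSet P i j (interferers s i j) ∩
        net.successSet P k l (interferers s k l)))
      = Psi (Finset.univ \ {i, k}) (net.psi (Finset.univ \ {i, k})) net.betaClosed i j k l := by
  have hfilter : (Finset.univ.filter fun s : Fin n → Fin net.slots => s i = κ ∧ s k = κ')
      = Finset.univ.filter fun s : Fin n → Fin net.slots =>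
        ∀ ν ∉ Finset.univ \ {i, k}, s ν = (fun ν => if ν = i then κ else κ') ν := by
    ext s
    simp only [Finset.mem_filter, Finset.mem_univ, true_and, Finset.mem_sdiff, not_not,
      Finset.mem_insert, Finset.mem_singleton, forall_eq_or_imp, forall_eq, if_true,
      if_neg hik.symm]
  have hcls : ∀ a : Fin net.slots, (if a = κ then 1 else if a = κ' then 2 else 0) < 3 :=
    fun a => by split_ifs <;> simp
  have hmac := sum_slots_eq_sum_macroStates (Finset.univ \ {i, k}) hcls
    (fun ν => if ν = i then κ else κ')
    fun c => net.betaClosed 1 i j k c * net.betaClosed 2 k l i c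
  unfold Psi
  rw [Finset.sum_congr rfl (g := fun c => (∏ ν ∈ Finset.univ \ {i, k},
    ((Finset.univ.filter fun a =>
      (if a = κ then 1 else if a = κ' then 2 else 0) = c ν).card : ℝ)) *
      (net.betaClosed 1 i j k c * net.betaClosed 2 k l i c)) fun c hc => by
    rw [net.prod_card_eq_psi _ hκ hc, mul_assoc], ← hmac, ← hfilter]
  refine Finset.sum_congr rfl fun s hs => ?_
  obtain ⟨hsi, hsk⟩ := (Finset.mem_filter.1 hs).2
  rw [h.measureReal_successSet_inter hij hkl (by simp [interferers]) (by simp [interferers])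
    fun _ => ?_]
  · congr 1
    · refine h.measureReal_successSet_eq_gamma hij (fun ν hν => ?_) (by simp) (by simp)
        fun ν hν => ?_
      · obtain ⟨⟨h1, h2⟩, h3⟩ := mem_interferers.1 hν
        have h4 : ν ≠ k := by
          rintro rfl
          exact hκ (hsi.symm.trans (h3.symm.trans hsk))
        simp [h1, h2, h4]
      · obtain ⟨h1, h2, h4⟩ : ν ≠ i ∧ ν ≠ j ∧ ν ≠ k := by simpa using hν
        by_cases hνκ : s ν = κ
        · simp [mem_interferers, hsi, hνκ, h1, h2, h4]
        · by_cases hνκ' : s ν = κ' <;> simp [mem_interferers, hsi, hνκ, hνκ', hκ.symm, h1, h4]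
    · refine h.measureReal_successSet_eq_gamma hkl (fun ν hν => ?_) (by simp) (by simp)
        fun ν hν => ?_
      · obtain ⟨⟨h1, h2⟩, h3⟩ := mem_interferers.1 hν
        have h4 : ν ≠ i := by
          rintro rfl
          exact hκ (hsi.symm.trans (h3.trans hsk))
        simp [h1, h2, h4]
      · obtain ⟨h1, h2, h4⟩ : ν ≠ k ∧ ν ≠ l ∧ ν ≠ i := by simpa using hν
        by_cases hνκ : s ν = κ
        · simp [mem_interferers, hsk, hνκ, hκ, h1, h4]
        · by_cases hνκ' : s ν = κ' <;>
            simp [mem_interferers, hsk, hνκ, hνκ', hκ.symm, h1, h2, h4]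
  · have hT : ∀ a ∈ insert i (interferers s i j), s a = κ := fun a ha => by
      rcases Finset.mem_insert.1 ha with rfl | ha
      · exact hsi
      · exact (mem_interferers.1 ha).2.trans hsi
    have hT' : ∀ a ∈ insert k (interferers s k l), s a = κ' := fun a ha => by
      rcases Finset.mem_insert.1 ha with rfl | ha
      · exact hsk
      · exact (mem_interferers.1 ha).2.trans hsk
    exact Finset.disjoint_left.2 fun a ha ha' => hκ ((hT a ha).symm.trans (hT' a ha'))

theorem covariance_X_same_transmitter (h : net.IsNakagamiALOHA Pr P S) {i j l : Fin n}
    (hij : i ≠ j) (hil : i ≠ l) (hjl : j ≠ l) :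
    cov[net.X P S i j, net.X P S i l; Pr]
      = Phi (Finset.univ \ {i}) (net.phi (Finset.univ \ {i}))
            (fun x y _ c => net.alphaSame x y c) i j i l / (net.slots : ℝ) ^ (n - 1)
          - (∫ ω, net.X P S i j ω ∂Pr) * ∫ ω, net.X P S i l ω ∂Pr := by
  have hm := net.slots_pos_real
  have hn : n - 1 + 1 = n := Nat.sub_add_cancel (Nat.one_le_of_lt i.2)
  have hpow : (net.slots : ℝ) ^ n = net.slots ^ (n - 1) * net.slots := by rw [← pow_succ, hn]
  rw [h.covariance_X hij hil, ← Finset.sum_fiberwise Finset.univ fun s => s i,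
    Finset.sum_congr rfl fun κ _ => h.sum_same_transmitter hij hil hjl κ, Finset.sum_const,
    Finset.card_univ, Fintype.card_fin, nsmul_eq_mul, hpow]
  congr 1
  field_simp

theorem covariance_X_of_ne_transmitter (h : net.IsNakagamiALOHA Pr P S) {i j k l : Fin n}
    (hij : i ≠ j) (hkl : k ≠ l) (hik : i ≠ k) :
    cov[net.X P S i j, net.X P S k l; Pr]
      = (if l = j then 0 else 1) / (net.slots : ℝ) ^ (n - 1)
            * Phi (Finset.univ \ {i, k}) (net.phi (Finset.univ \ {i, k}))
                net.alphaClosed i j k l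
          + ((net.slots : ℝ) - 1) / (net.slots : ℝ) ^ (n - 1)
            * Psi (Finset.univ \ {i, k}) (net.psi (Finset.univ \ {i, k}))
                net.betaClosed i j k l
          - (∫ ω, net.X P S i j ω ∂Pr) * ∫ ω, net.X P S k l ω ∂Pr := by
  have hm := net.slots_pos_real
  have hn : n - 1 + 1 = n := Nat.sub_add_cancel (Nat.one_le_of_lt i.2)
  have hpow : (net.slots : ℝ) ^ n = net.slots ^ (n - 1) * net.slots := by rw [← pow_succ, hn]
  rw [h.covariance_X hij hkl]
  congr 1
  set A := Phi (Finset.univ \ {i, k}) (net.phi (Finset.univ \ {i, k})) net.alphaClosed i j k l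
  set B := Psi (Finset.univ \ {i, k}) (net.psi (Finset.univ \ {i, k})) net.betaClosed i j k l
  -- Writing the diagonal as a correction to the constant `B` lets the double sum over slots
  -- collapse to `m` same-slot terms and `m * (m - 1)` different-slot terms.
  have hinner : ∀ κ κ' : Fin net.slots, (∑ s : Fin n → Fin net.slots with s i = κ ∧ s k = κ',
      Pr.real (net.successSet P i j (interferers s i j) ∩
        net.successSet P k l (interferers s k l)))
      = (if κ = κ' then (if l = j then 0 else 1) * A - B else 0) + B := by
    intro κ κ'
    by_cases hκ : κ = κ'
    · subst hκ
      rw [if_pos rfl, sub_add_cancel]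
      exact h.sum_same_slot hij hkl hik κ
    · rw [if_neg hκ, zero_add]
      exact h.sum_different_slots hij hkl hik hκ
  have hsum : (∑ s : Fin n → Fin net.slots,
      Pr.real (net.successSet P i j (interferers s i j) ∩
        net.successSet P k l (interferers s k l)))
      = net.slots * ((if l = j then 0 else 1) * A - B + net.slots * B) := by
    rw [← Finset.sum_fiberwise Finset.univ fun s : Fin n → Fin net.slots => s i]
    rw [Finset.sum_congr rfl (g := fun _ => (if l = j then 0 else 1) * A - B + net.slots * B)
      fun κ _ => ?_]
    · rw [Finset.sum_const, Finset.card_univ, Fintype.card_fin, nsmul_eq_mul]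
    rw [← Finset.sum_fiberwise _ fun s : Fin n → Fin net.slots => s k]
    simp_rw [Finset.filter_filter, hinner, Finset.sum_add_distrib]
    simp
  rw [hsum, hpow]
  field_simp
  ring

end IsNakagamiALOHA

end Network

theorem corollary2 {n : ℕ} (hn : 3 ≤ n) (net : Network n)
    {Ω : Type*} [MeasurableSpace Ω] (Pr : Measure Ω) [IsProbabilityMeasure Pr]
    (P : Fin n → Fin n → Ω → ℝ) (S : Fin n → Ω → Fin net.slots)
    (hmodel : net.IsNakagamiALOHA Pr P S) :
    -- expectations
    (∀ i j : Fin n, i ≠ j →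
      ∫ ω, net.X P S i j ω ∂Pr
        = net.gamma i j (Finset.univ \ {i, j}) fun _ => 1 / (net.slots : ℝ)) ∧
    -- state coefficients
    (∀ x y : Fin n, x ≠ y → ∀ c ∈ Network.macroStates (Finset.univ \ {x}) 2,
      net.alpha Pr P x y x c = net.alphaSame x y c) ∧
    (∀ x y z : Fin n, x ≠ y → x ≠ z → ∀ c ∈ Network.macroStates (Finset.univ \ {x, z}) 2,
      net.alpha Pr P x y z c = net.alphaClosed x y z c) ∧
    (∀ x y z : Fin n, x ≠ y → x ≠ z → ∀ d ∈ ({1, 2} : Finset ℕ),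
      ∀ c ∈ Network.macroStates (Finset.univ \ {x, z}) 3,
        net.beta Pr P d x y z c = net.betaClosed d x y z c) ∧
    -- covariances of two links with the same transmitter
    (∀ i j l : Fin n, i ≠ j → i ≠ l → j ≠ l →
      cov[net.X P S i j, net.X P S i l; Pr]
        = Network.Phi (Finset.univ \ {i}) (net.phi (Finset.univ \ {i}))
            (fun x y _ c => net.alphaSame x y c) i j i l / (net.slots : ℝ) ^ (n - 1)
          - (∫ ω, net.X P S i j ω ∂Pr) * ∫ ω, net.X P S i l ω ∂Pr) ∧
    -- covariances of two links with different transmitters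
    (∀ i j k l : Fin n, i ≠ j → k ≠ l → i ≠ k →
      cov[net.X P S i j, net.X P S k l; Pr]
        = (if l = j then 0 else 1) / (net.slots : ℝ) ^ (n - 1)
            * Network.Phi (Finset.univ \ {i, k}) (net.phi (Finset.univ \ {i, k}))
                net.alphaClosed i j k l
          + ((net.slots : ℝ) - 1) / (net.slots : ℝ) ^ (n - 1)
            * Network.Psi (Finset.univ \ {i, k}) (net.psi (Finset.univ \ {i, k}))
                net.betaClosed i j k l
          - (∫ ω, net.X P S i j ω ∂Pr) * ∫ ω, net.X P S k l ω ∂Pr) := by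
  refine ⟨fun i j hij => hmodel.integral_X_eq_gamma hij, fun x y hxy c hc => ?_,
    fun x y z hxy _ c hc => hmodel.alpha_eq_alphaClosed hxy
      (Network.lt_of_mem_macroStates zero_lt_two hc),
    fun x y z hxy _ d _ c _ => hmodel.beta_eq_betaClosed hxy d c,
    fun i j l hij hil hjl => hmodel.covariance_X_same_transmitter hij hil hjl,
    fun i j k l hij hkl hik => hmodel.covariance_X_of_ne_transmitter hij hkl hik⟩
  rw [hmodel.alpha_eq_alphaClosed hxy (Network.lt_of_mem_macroStates zero_lt_two hc),
    net.alphaClosed_self]
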